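/- Let $\zeta$ denote the Riemann zeta function, analytically continued to $\mathbb{C}\setminus\{1\}$. For every complex number $k \neq 1$, $$\zeta(k)=\frac{1}{k-1}+\frac12+\frac{\pi}{k-1}\int_{0}^{\pi/2}\bigl(\sec v\,\operatorname{csch}(\pi\tan v)\bigr)^2\left(1-\frac{\cos((k-1)v)}{(\cos v)^{1-k}}\right)dv,$$ where the integral over $0<v<\pi/2$ converges absolutely, $\sec v = 1/\cos v$, $\operatorname{csch} x = 1/\sinh x$, and $(\cos v)^{1-k}=\exp\bigl((1-k)\log\cos v\bigr)$ with the real logarithm of $\cos v>0$. -/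

import Mathlib

/-- The secant of a real number, `sec v = 1 / cos v`. -/
noncomputable def realSec (v : ℝ) : ℝ := 1 / Real.cos v

/-- The hyperbolic cosecant of a real number, `csch x = 1 / sinh x`. -/
noncomputable def realCsch (x : ℝ) : ℝ := 1 / Real.sinh x

/-- The integrand `(sec v · csch (π tan v))² (1 - cos ((k - 1) v) / (cos v) ^ (1 - k))`, for complex
`k` and real `v`. For `0 < v < π / 2` the base `cos v` is a positive real, so that the complex power
is `exp ((1 - k) log (cos v))` with the real logarithm. -/
noncomputable def zetaIntegrand (k : ℂ) (v : ℝ) : ℂ :=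
  (((realSec v * realCsch (Real.pi * Real.tan v)) ^ 2 : ℝ) : ℂ) *
    (1 - Complex.cos ((k - 1) * (v : ℂ)) / ((Real.cos v : ℝ) : ℂ) ^ (1 - k))

open Real Set MeasureTheory

/-! Write `a = k - 1`. For `Re a > 0`, Euler's integral with complex rate `1 - i tan v = 1 / (cos v
· exp (i v))` shows that `Γ(a) (1 - cos (a v) (cos v)^a)` is the integral of `exp (-t) t^(a-1) (1 -
cos (t tan v))` over `t > 0` (`Gamma_mul_one_sub_exp_pair`). After Fubini the inner integral over
`v` is elementary: the substitution `x = tan v`, the expansion of `csch²` in exponentials and the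
partial fractions of the cotangent give `t / (1 - exp (-t)) - t / 2 - 1`
(`integral_zetaWeight_mul_one_sub_cos`). Integrating these three terms against `exp (-t) t^(a-1)`
gives `Γ(k) ζ(k) - Γ(k) / 2 - Γ(k-1)`; division by `Γ(k-1)` settles `Re k > 1`. The integrand is
bounded uniformly for `k` in bounded sets, so the integral is entire in `k`. The identity theorem,
applied to the entire function `(k-1) ζ(k)`, covers all other `k`. -/

/-! ### Bounds for the weight and the oscillating factor -/

theorem self_div_sinh_pi_mul_le {x : ℝ} (hx : 0 < x) :
    x / sinh (π * x) ≤ exp (-(π / 2 * x)) := by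
  have hy : 0 < π * x := by positivity
  have h1 : sinh (π * x) = 2 * sinh (π * x / 2) * cosh (π * x / 2) := by
    rw [← Real.sinh_two_mul]; congr 1; ring
  have h2 : π * x / 2 ≤ sinh (π * x / 2) := Real.self_le_sinh_iff.2 (by positivity)
  have h3 : exp (π * x / 2) / 2 ≤ cosh (π * x / 2) := by
    rw [Real.cosh_eq]; linarith [exp_pos (-(π * x / 2))]
  have h4 : π * x * (exp (π * x / 2) / 2) ≤ sinh (π * x) := by
    rw [h1]
    have : 0 < exp (π * x / 2) / 2 := by positivity
    exact (mul_le_mul_of_nonneg_right (by linarith) this.le).trans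
      (mul_le_mul_of_nonneg_left h3 (by linarith))
  rw [div_le_iff₀ (Real.sinh_pos_iff.2 hy)]
  have h5 : exp (-(π / 2 * x)) * exp (π * x / 2) = 1 := by
    rw [← Real.exp_add]; simp; ring
  calc x = exp (-(π / 2 * x)) * (x * exp (π * x / 2)) := by
        linear_combination (-x) * h5
    _ ≤ exp (-(π / 2 * x)) * sinh (π * x) := by
        gcongr
        refine le_trans ?_ h4
        have : 0 < x * exp (π * x / 2) := by positivity
        nlinarith [pi_gt_three]

theorem one_add_pow_mul_exp_neg_pi_mul_le (n : ℕ) {x : ℝ} (hx : 0 ≤ x) :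
    (1 + x) ^ n * exp (-(π * x)) ≤ n.factorial * exp 1 := by
  have h := Real.pow_div_factorial_le_exp (1 + x) (by linarith) n
  rw [div_le_iff₀ (by positivity)] at h
  calc _ ≤ (exp (1 + x) * n.factorial) * exp (-(π * x)) := by gcongr
    _ = n.factorial * exp (1 + x + -(π * x)) := by rw [Real.exp_add (1 + x)]; ring
    _ ≤ _ := by gcongr; nlinarith [pi_gt_three]

theorem realSec_sq {v : ℝ} (hv : v ∈ Ioo 0 (π / 2)) : realSec v ^ 2 = 1 + tan v ^ 2 := by
  have hc : 0 < cos v := cos_pos_of_mem_Ioo ⟨by linarith [hv.1, pi_pos], hv.2⟩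
  rw [realSec, tan_eq_sin_div_cos]
  field_simp
  linarith [sin_sq_add_cos_sq v]

theorem one_le_realSec {v : ℝ} (hv : v ∈ Ioo 0 (π / 2)) : 1 ≤ realSec v := by
  have hc : 0 < cos v := cos_pos_of_mem_Ioo ⟨by linarith [hv.1, pi_pos], hv.2⟩
  rw [realSec, le_div_iff₀ hc]; linarith [cos_le_one v]

theorem realSec_le_one_add_tan {v : ℝ} (hv : v ∈ Ioo 0 (π / 2)) : realSec v ≤ 1 + tan v := by
  have ht := tan_pos_of_pos_of_lt_pi_div_two hv.1 hv.2
  have := realSec_sq hv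
  nlinarith [one_le_realSec hv]

/-- The weight `(sec v · csch (π tan v))²`. -/
noncomputable def zetaWeight (v : ℝ) : ℝ := (realSec v * realCsch (π * tan v)) ^ 2

theorem zetaWeight_nonneg (v : ℝ) : 0 ≤ zetaWeight v := sq_nonneg _

/-- The factor `tan²` cancels the double pole of `csch²` at `v = 0`, and the exponential decay of
`csch²` absorbs every power of `sec` near `π / 2`. -/
theorem zetaWeight_mul_le (n : ℕ) {v : ℝ} (hv : v ∈ Ioo 0 (π / 2)) :
    zetaWeight v * (tan v ^ 2 * realSec v ^ n) ≤ (n + 2).factorial * exp 1 := by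
  have ht := tan_pos_of_pos_of_lt_pi_div_two hv.1 hv.2
  have hs := one_le_realSec hv
  have h1 := self_div_sinh_pi_mul_le ht
  have h0 : 0 ≤ tan v / sinh (π * tan v) := by
    have := Real.sinh_nonneg_iff.2 (show 0 ≤ π * tan v by positivity)
    positivity
  calc zetaWeight v * (tan v ^ 2 * realSec v ^ n)
      = realSec v ^ (n + 2) * (tan v / sinh (π * tan v)) ^ 2 := by
        rw [zetaWeight, realCsch]; ring
    _ ≤ (1 + tan v) ^ (n + 2) * exp (-(π / 2 * tan v)) ^ 2 := by
        gcongr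
        exact realSec_le_one_add_tan hv
    _ = (1 + tan v) ^ (n + 2) * exp (-(π * tan v)) := by
        rw [← Real.exp_nat_mul]; congr 2; push_cast; ring
    _ ≤ _ := one_add_pow_mul_exp_neg_pi_mul_le _ ht.le

theorem log_cos_bounds {v : ℝ} (hv : v ∈ Ioo 0 (π / 2)) :
    |log (cos v)| ≤ tan v ∧ |log (cos v)| ≤ tan v ^ 2 ∧ exp |log (cos v)| = realSec v := by
  have hc : 0 < cos v := cos_pos_of_mem_Ioo ⟨by linarith [hv.1, pi_pos], hv.2⟩
  have hs := one_le_realSec hv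
  have h1 : |log (cos v)| = log (realSec v) := by
    rw [abs_of_nonpos (log_nonpos hc.le (cos_le_one v)), realSec, one_div, log_inv]
  rw [h1]
  have h2 := log_le_sub_one_of_pos (show 0 < realSec v by linarith)
  refine ⟨?_, ?_, exp_log (by linarith)⟩
  · linarith [realSec_le_one_add_tan hv]
  · nlinarith [realSec_sq hv]

/-- In the average of the two exponentials the linear terms `± a v i` cancel, leaving `a log (cos
v)`, which is itself `O(tan²)`. The Taylor remainders are quadratic, at the cost of a factor `exp (N
|log (cos v)|) = sec^N`. -/
theorem norm_one_sub_exp_pair_le (N : ℕ) (a : ℂ) (ha : ‖a‖ ≤ N) {v : ℝ} (hv : v ∈ Ioo 0 (π / 2)) :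
    ‖1 - (Complex.exp (a * (log (cos v) + v * Complex.I)) +
        Complex.exp (a * (log (cos v) - v * Complex.I))) / 2‖ ≤
      (N + N ^ 2 * 4 * exp (N * (π / 2))) * (tan v ^ 2 * realSec v ^ N) := by
  obtain ⟨hL1, hL2, hL3⟩ := log_cos_bounds hv
  have ht := tan_pos_of_pos_of_lt_pi_div_two hv.1 hv.2
  have hvt := lt_tan hv.1 hv.2
  have hs := one_le_realSec hv
  set L := log (cos v)
  have key : ∀ z : ℂ, ‖z‖ ≤ |L| + v →
      ‖Complex.exp (a * z) - 1 - a * z‖ ≤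
        N ^ 2 * 4 * exp (N * (π / 2)) * (tan v ^ 2 * realSec v ^ N) := by
    intro z hz
    have h := Complex.norm_exp_sub_sum_le_norm_mul_exp (a * z) 2
    simp only [Finset.sum_range_succ, Finset.sum_range_zero, pow_zero, pow_one, zero_add,
      Nat.factorial, Nat.cast_one, div_one, mul_one, norm_mul] at h
    rw [sub_sub]
    refine h.trans ?_
    have h1 : ‖z‖ ≤ 2 * tan v := by linarith
    have h2 : ‖a‖ * ‖z‖ ≤ N * (π / 2) + N * |L| := by
      calc _ ≤ N * (|L| + v) := by gcongr
        _ ≤ N * (|L| + π / 2) := by gcongr; exact hv.2.le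
        _ = _ := by ring
    calc (‖a‖ * ‖z‖) ^ 2 * exp (‖a‖ * ‖z‖)
        ≤ (N * (2 * tan v)) ^ 2 * exp (N * (π / 2) + N * |L|) := by gcongr
      _ = _ := by rw [Real.exp_add, Real.exp_nat_mul |L|, hL3]; ring
  have hn : ∀ z : ℂ, z = v * Complex.I → ‖(L : ℂ)‖ + ‖z‖ = |L| + v := by
    rintro _ rfl
    simp [abs_of_pos hv.1]
  have k1 := key (L + v * Complex.I) ((norm_add_le _ _).trans_eq (hn _ rfl))
  have k2 := key (L - v * Complex.I) ((norm_sub_le _ _).trans_eq (hn _ rfl))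
  set E := N ^ 2 * 4 * exp (N * (π / 2)) * (tan v ^ 2 * realSec v ^ N)
  have h3 : ‖a * (L : ℂ)‖ ≤ N * (tan v ^ 2 * realSec v ^ N) := by
    rw [norm_mul, Complex.norm_real, norm_eq_abs]
    have : tan v ^ 2 * 1 ≤ tan v ^ 2 * realSec v ^ N := by gcongr; exact one_le_pow₀ hs
    gcongr; linarith
  have e : 1 - (Complex.exp (a * (L + v * Complex.I)) + Complex.exp (a * (L - v * Complex.I))) / 2
      = -(a * L) - ((1 / 2 : ℝ) : ℂ) * (Complex.exp (a * (L + v * Complex.I)) - 1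
          - a * (L + v * Complex.I))
        - ((1 / 2 : ℝ) : ℂ) * (Complex.exp (a * (L - v * Complex.I)) - 1
          - a * (L - v * Complex.I)) := by
    push_cast; ring
  rw [e]
  refine (norm_sub_le _ _).trans ?_
  refine (add_le_add_left (norm_sub_le _ _) _).trans ?_
  rw [norm_neg, norm_mul (((1 / 2 : ℝ) : ℂ)), norm_mul (((1 / 2 : ℝ) : ℂ)), Complex.norm_real]
  norm_num
  norm_num at h3 k1 k2
  rw [add_mul]
  linarith

/-! ### Convergence of the integral and holomorphy in `k` -/

theorem zetaIntegrand_eq (k : ℂ) {v : ℝ} (hv : v ∈ Ioo 0 (π / 2)) :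
    zetaIntegrand k v = zetaWeight v *
      (1 - (Complex.exp ((k - 1) * (log (cos v) + v * Complex.I)) +
        Complex.exp ((k - 1) * (log (cos v) - v * Complex.I))) / 2) := by
  have hc : 0 < cos v := cos_pos_of_mem_Ioo ⟨by linarith [hv.1, pi_pos], hv.2⟩
  have hc' : ((cos v : ℝ) : ℂ) ≠ 0 := by exact_mod_cast hc.ne'
  rw [zetaIntegrand, zetaWeight, Complex.cpow_def_of_ne_zero hc', ← Complex.ofReal_log hc.le,
    div_eq_mul_inv, ← Complex.exp_neg, Complex.cos, div_mul_eq_mul_div, add_mul,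
    ← Complex.exp_add, ← Complex.exp_add]
  congr 6 <;> ring_nf

theorem exists_norm_zetaIntegrand_le (R : ℝ) :
    ∃ C, ∀ k : ℂ, ‖k - 1‖ ≤ R → ∀ v ∈ Ioo 0 (π / 2), ‖zetaIntegrand k v‖ ≤ C := by
  obtain ⟨N, hN⟩ := exists_nat_ge R
  refine ⟨(N + N ^ 2 * 4 * exp (N * (π / 2))) * ((N + 2).factorial * exp 1), fun k hk v hv ↦ ?_⟩
  rw [zetaIntegrand_eq k hv, norm_mul, Complex.norm_real, norm_of_nonneg (zetaWeight_nonneg v)]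
  calc _ ≤ zetaWeight v * ((N + N ^ 2 * 4 * exp (N * (π / 2))) * (tan v ^ 2 * realSec v ^ N)) := by
        gcongr
        · exact zetaWeight_nonneg v
        · exact norm_one_sub_exp_pair_le N _ (hk.trans hN) hv
    _ = (N + N ^ 2 * 4 * exp (N * (π / 2))) * (zetaWeight v * (tan v ^ 2 * realSec v ^ N)) := by
        ring
    _ ≤ _ := mul_le_mul_of_nonneg_left (zetaWeight_mul_le N hv) (by positivity)

theorem measurable_zetaWeight : Measurable zetaWeight := by
  unfold zetaWeight realSec realCsch
  have : Measurable tan := by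
    rw [show tan = fun x ↦ sin x / cos x from funext tan_eq_sin_div_cos]; fun_prop
  fun_prop

theorem measurable_zetaIntegrand (k : ℂ) : Measurable (zetaIntegrand k) := by
  have := measurable_zetaWeight
  unfold zetaWeight at this
  unfold zetaIntegrand
  fun_prop

theorem integrableOn_zetaIntegrand (k : ℂ) : IntegrableOn (zetaIntegrand k) (Ioo 0 (π / 2)) := by
  obtain ⟨C, hC⟩ := exists_norm_zetaIntegrand_le ‖k - 1‖
  refine Measure.integrableOn_of_bounded (M := C) (by simp)
    (measurable_zetaIntegrand k).aestronglyMeasurable ?_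
  filter_upwards [ae_restrict_mem measurableSet_Ioo] with v hv using hC k le_rfl v hv

theorem differentiable_integral_zetaIntegrand :
    Differentiable ℂ fun k ↦ ∫ v in Ioo 0 (π / 2), zetaIntegrand k v := by
  intro k₀
  -- One unit is for `k` in the ball around `k₀`, one for the unit circle around `k` on which
  -- Cauchy's estimate bounds the derivative by the same `C`.
  obtain ⟨C, hC⟩ := exists_norm_zetaIntegrand_le (‖k₀ - 1‖ + 2)
  let F' : ℂ → ℝ → ℂ := fun k v ↦ zetaWeight v *
      (-(((log (cos v) + v * Complex.I) * Complex.exp ((k - 1) * (log (cos v) + v * Complex.I)) +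
        (log (cos v) - v * Complex.I) *
          Complex.exp ((k - 1) * (log (cos v) - v * Complex.I))) / 2))
  have hd : ∀ v ∈ Ioo 0 (π / 2), ∀ k, HasDerivAt (fun k ↦ zetaIntegrand k v) (F' k v) k := by
    intro v hv k
    simp only [zetaIntegrand_eq _ hv]
    have h : ∀ z : ℂ, HasDerivAt (fun k ↦ Complex.exp ((k - 1) * z))
        (z * Complex.exp ((k - 1) * z)) k := fun z ↦ by
      have := (((hasDerivAt_id' k).sub_const 1).mul_const z).cexp
      exact this.congr_deriv (by ring)
    exact ((((h _).add (h _)).div_const 2).const_sub 1).const_mul _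
  refine (hasDerivAt_integral_of_dominated_loc_of_deriv_le (s := Metric.ball k₀ 1) (F' := F')
    (bound := fun _ ↦ C) (Metric.ball_mem_nhds _ one_pos)
    (.of_forall fun k ↦ (measurable_zetaIntegrand k).aestronglyMeasurable)
    (integrableOn_zetaIntegrand k₀) ?_ ?_ (by simp) ?_).2.differentiableAt
  · have := measurable_zetaWeight
    exact Measurable.aestronglyMeasurable (by fun_prop)
  · filter_upwards [ae_restrict_mem measurableSet_Ioo] with v hv k hk
    rw [← (hd v hv k).deriv]
    have hdiff : Differentiable ℂ fun k ↦ zetaIntegrand k v :=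
      fun k ↦ (hd v hv k).differentiableAt
    refine (Complex.norm_deriv_le_of_forall_mem_sphere_norm_le one_pos hdiff.diffContOnCl
      fun w hw ↦ hC w ?_ v hv).trans_eq (div_one C)
    rw [Metric.mem_sphere, dist_eq_norm] at hw
    rw [Metric.mem_ball, dist_eq_norm] at hk
    calc ‖w - 1‖ = ‖(w - k) + (k - k₀) + (k₀ - 1)‖ := by congr 1; ring
      _ ≤ _ := norm_add₃_le
      _ ≤ _ := by linarith
  · filter_upwards [ae_restrict_mem measurableSet_Ioo] with v hv k _ using hd v hv k

/-! ### The cosine integral of `csch²` -/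

theorem integral_exp_neg_mul_one_sub_cos {b : ℝ} (hb : 0 < b) (t : ℝ) :
    IntegrableOn (fun x ↦ exp (-(b * x)) * (1 - cos (t * x))) (Ioi 0) ∧
    ∫ x in Ioi 0, exp (-(b * x)) * (1 - cos (t * x)) = t ^ 2 / (b * (b ^ 2 + t ^ 2)) := by
  have h1 : ((-b : ℝ) : ℂ).re < 0 := by simpa
  have h2 : (-b + t * Complex.I : ℂ).re < 0 := by simpa
  have e : (fun x : ℝ ↦ exp (-(b * x)) * (1 - cos (t * x))) = fun x : ℝ ↦
      RCLike.re (Complex.exp ((-b : ℝ) * x) - Complex.exp ((-b + t * Complex.I) * x)) := by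
    ext x
    simp [Complex.exp_re]
    ring
  have hi := (integrableOn_exp_mul_complex_Ioi h1 0).sub (integrableOn_exp_mul_complex_Ioi h2 0)
  rw [e]
  refine ⟨hi.re, ?_⟩
  refine (integral_re hi).trans ?_
  refine (congrArg _ (integral_sub (integrableOn_exp_mul_complex_Ioi h1 0)
    (integrableOn_exp_mul_complex_Ioi h2 0))).trans ?_
  rw [integral_exp_mul_complex_Ioi h1, integral_exp_mul_complex_Ioi h2]
  have h3 : b ^ 2 + t ^ 2 ≠ 0 := by positivity
  have h4 : b * b + t * t ≠ 0 := by rwa [← sq, ← sq]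
  simp [Complex.div_re, Complex.normSq_apply]
  field_simp
  ring

/-- With `q = exp (-2πx)`, `csch² (πx) = 4 q / (1 - q)² = 4 ∑ n qⁿ`; the zero term `n = 0` is
dropped. -/
theorem hasSum_csch_sq {x : ℝ} (hx : 0 < x) :
    HasSum (fun n : ℕ ↦ 4 * (n + 1 : ℝ) * exp (-(2 * π * (n + 1) * x)))
      (realCsch (π * x) ^ 2) := by
  have hr : exp (-(2 * π * x)) < 1 := by
    rw [exp_lt_one_iff]; have := pi_pos; simp; positivity
  have h : HasSum (fun n : ℕ ↦ (n : ℝ) * exp (-(2 * π * x)) ^ n)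
      (exp (-(2 * π * x)) / (1 - exp (-(2 * π * x))) ^ 2) :=
    hasSum_coe_mul_geometric_of_norm_lt_one (by rwa [norm_of_nonneg (exp_pos _).le])
  have h' := ((hasSum_nat_add_iff' 1).2 h).mul_left 4
  have hf : ∀ n : ℕ, 4 * (n + 1 : ℝ) * exp (-(2 * π * (n + 1) * x)) =
      4 * ((n + 1 : ℕ) * exp (-(2 * π * x)) ^ (n + 1)) := fun n ↦ by
    rw [← Real.exp_nat_mul, mul_assoc]
    push_cast
    congr 3
    ring
  have ha : realCsch (π * x) ^ 2 = 4 * (exp (-(2 * π * x)) / (1 - exp (-(2 * π * x))) ^ 2 -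
      ∑ i ∈ Finset.range 1, (i : ℝ) * exp (-(2 * π * x)) ^ i) := by
    have e1 : exp (-(2 * π * x)) = exp (-(π * x)) ^ 2 := by
      rw [← Real.exp_nat_mul]; congr 1; push_cast; ring
    have e2 : exp (π * x) * exp (-(π * x)) = 1 := by rw [← Real.exp_add]; simp
    have e3 : exp (-(π * x)) ≠ 0 := (exp_pos _).ne'
    have e4 : exp (π * x) = 1 / exp (-(π * x)) := by field_simp; exact e2
    rw [e1] at hr ⊢
    have e5 : 1 - exp (-(π * x)) ^ 2 ≠ 0 := by linarith
    rw [realCsch, Real.sinh_eq, e4]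
    simp only [Finset.range_one, Finset.sum_singleton, Nat.cast_zero, zero_mul, sub_zero]
    field_simp
    norm_num
  simp_rw [hf, ha]
  exact h'

/-- Compare the partial fractions and the `q`-expansion of `π cot (π x)` at `x = i t / (2π)`, where
`q = exp (-t)`. -/
theorem hasSum_div_sq_add_sq {t : ℝ} (ht : 0 < t) :
    HasSum (fun n : ℕ ↦ t / ((2 * π * (n + 1)) ^ 2 + t ^ 2))
      (1 / (2 * (1 - exp (-t))) - 1 / 4 - 1 / (2 * t)) := by
  have hpi := pi_pos
  have hsum : Summable fun n : ℕ ↦ t / ((2 * π * (n + 1)) ^ 2 + t ^ 2) := by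
    have h := ((summable_nat_add_iff 1).2
      (Real.summable_one_div_nat_pow.2 (one_lt_two))).mul_left t
    refine Summable.of_nonneg_of_le (fun n ↦ by positivity) (fun n ↦ ?_) h
    rw [← mul_one_div]
    push_cast
    gcongr
    nlinarith [sq_nonneg t, pi_gt_three, show (0 : ℝ) < n + 1 by positivity,
      show (1 : ℝ) * (n + 1) ≤ 2 * π * (n + 1) by gcongr; linarith [pi_gt_three]]
  refine hsum.hasSum_iff.2 ?_
  let x : ℂ := (t / (2 * π) : ℝ) * Complex.I
  have him : 0 < x.im := by
    simp only [x, Complex.im_ofReal_mul, Complex.I_im, mul_one]; positivity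
  have hx : x ∈ Complex.integerComplement := by
    rintro ⟨n, hn⟩
    rw [← hn] at him
    simp at him
  have hc := cot_series_rep' hx
  have hq := pi_mul_cot_pi_q_exp ⟨x, him⟩
  have hexp : Complex.exp (2 * π * Complex.I * x) = (exp (-t) : ℝ) := by
    rw [Complex.ofReal_exp]
    congr 1
    have : (π : ℂ) ≠ 0 := by exact_mod_cast hpi.ne'
    simp only [x]
    push_cast
    field_simp
    linear_combination (t : ℂ) * Complex.I_sq
  have hlt : exp (-t) < 1 := by simpa
  have hgeo : ∑' n : ℕ, Complex.exp (2 * π * Complex.I * x) ^ n = ((1 - exp (-t))⁻¹ : ℝ) := by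
    rw [hexp, tsum_geometric_of_norm_lt_one]
    · push_cast; rfl
    · rw [Complex.norm_real, norm_of_nonneg (exp_pos _).le]; exact hlt
  change π * Complex.cot (π * x) = π * Complex.I - 2 * π * Complex.I *
    ∑' n : ℕ, Complex.exp (2 * π * Complex.I * x) ^ n at hq
  rw [hq, hgeo] at hc
  have hterm : ∀ n : ℕ, 1 / (x - (n + 1)) + 1 / (x + (n + 1)) =
      (-4 * π * Complex.I) * ((t / ((2 * π * (n + 1)) ^ 2 + t ^ 2) : ℝ) : ℂ) := by
    intro n
    have h1 : x - (n + 1) ≠ 0 := fun h ↦ by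
      have := congrArg Complex.im h; simp at this; linarith
    have h2 : x + (n + 1) ≠ 0 := fun h ↦ by
      have := congrArg Complex.im h; simp at this; linarith
    have h3 : ((2 * π * (n + 1)) ^ 2 + t ^ 2 : ℂ) ≠ 0 := by
      have : (2 * π * (n + 1)) ^ 2 + t ^ 2 ≠ 0 := by positivity
      exact_mod_cast this
    have h4 : (π : ℂ) ≠ 0 := by exact_mod_cast hpi.ne'
    have h5 : 2 * π * x = t * Complex.I := by simp only [x]; push_cast; field_simp
    have h6 : x ^ 2 = - t ^ 2 / (4 * π ^ 2) := by
      field_simp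
      linear_combination (2 * π * x + t * Complex.I) * h5 + t ^ 2 * Complex.I_sq
    have h7 : (x - (n + 1)) * (x + (n + 1)) = -((2 * π * (n + 1)) ^ 2 + t ^ 2) / (4 * π ^ 2) := by
      field_simp
      field_simp at h6
      linear_combination h6
    have h8 : 1 * (x + (n + 1)) + (x - (n + 1)) * 1 = t * Complex.I / π := by
      field_simp
      linear_combination h5
    rw [div_add_div _ _ h1 h2, h7, h8]
    push_cast
    generalize (2 * π * (n + 1) : ℂ) ^ 2 + t ^ 2 = D at h3 ⊢
    field_simp
  simp_rw [hterm] at hc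
  rw [tsum_mul_left, ← Complex.ofReal_tsum] at hc
  have hx' : 1 / x = -(2 * π / t : ℝ) * Complex.I := by
    have h4 : (π : ℂ) ≠ 0 := by exact_mod_cast hpi.ne'
    have h5 : (t : ℂ) ≠ 0 := by exact_mod_cast ht.ne'
    simp only [x]
    push_cast
    field_simp
    linear_combination Complex.I_sq
  rw [hx'] at hc
  have h0 : 1 - exp (-t) ≠ 0 := by linarith
  generalize ∑' n : ℕ, t / ((2 * π * (n + 1)) ^ 2 + t ^ 2) = S at hc ⊢
  generalize 1 - exp (-t) = u at hc h0 ⊢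
  have hr : π - 2 * π * u⁻¹ + 2 * π / t = -4 * π * S := by
    apply Complex.ofReal_injective
    apply mul_left_cancel₀ Complex.I_ne_zero
    push_cast at hc ⊢
    linear_combination hc
  field_simp at hr ⊢
  linarith

/-- All terms of the exponential expansion are nonnegative, so termwise integration only needs the
sum of the integrals to converge. -/
theorem integral_csch_sq_mul_one_sub_cos {t : ℝ} (ht : 0 < t) :
    π * ∫ x in Ioi 0, realCsch (π * x) ^ 2 * (1 - cos (t * x)) =
      t / (1 - exp (-t)) - t / 2 - 1 := by
  have hpi := pi_pos
  have hb : ∀ n : ℕ, 0 < 2 * π * (n + 1) := fun n ↦ by positivity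
  let F : ℕ → ℝ → ℝ := fun n x ↦
    4 * (n + 1 : ℝ) * (exp (-(2 * π * (n + 1) * x)) * (1 - cos (t * x)))
  have hF0 : ∀ n x, 0 ≤ F n x := fun n x ↦ by
    have : 0 ≤ 1 - cos (t * x) := by linarith [cos_le_one (t * x)]
    positivity
  have hFi : ∀ n, IntegrableOn (F n) (Ioi 0) := fun n ↦
    (integral_exp_neg_mul_one_sub_cos (hb n) t).1.const_mul _
  have hFint : ∀ n, ∫ x in Ioi 0, F n x =
      2 * t / π * (t / ((2 * π * (n + 1)) ^ 2 + t ^ 2)) := fun n ↦ by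
    rw [integral_const_mul, (integral_exp_neg_mul_one_sub_cos (hb n) t).2]
    have := hb n
    have : (2 * π * (n + 1)) ^ 2 + t ^ 2 ≠ 0 := by positivity
    field_simp
    norm_num
  have hs := (hasSum_div_sq_add_sq ht).mul_left (2 * t / π)
  have h := hasSum_integral_of_summable_integral_norm (μ := volume.restrict (Ioi 0)) hFi (by
    simp_rw [norm_of_nonneg (hF0 _ _), hFint]; exact hs.summable)
  simp_rw [hFint] at h
  have e : ∫ x in Ioi 0, ∑' n, F n x = ∫ x in Ioi 0, realCsch (π * x) ^ 2 * (1 - cos (t * x)) := by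
    refine setIntegral_congr_fun measurableSet_Ioi fun x hx ↦ ?_
    have := (hasSum_csch_sq hx).mul_right (1 - cos (t * x))
    simpa only [F, mul_assoc] using this.tsum_eq
  rw [← e, h.unique hs]
  have hlt : exp (-t) < 1 := by simpa
  have h0 : 1 - exp (-t) ≠ 0 := by linarith
  field_simp
  ring

theorem tan_image_Ioo : tan '' Ioo 0 (π / 2) = Ioi 0 := by
  ext x
  constructor
  · rintro ⟨v, hv, rfl⟩
    exact tan_pos_of_pos_of_lt_pi_div_two hv.1 hv.2
  · intro hx
    exact ⟨arctan x, ⟨arctan_pos.2 hx, arctan_lt_pi_div_two x⟩, tan_arctan x⟩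

theorem integral_zetaWeight_mul_one_sub_cos {t : ℝ} (ht : 0 < t) :
    π * ∫ v in Ioo 0 (π / 2), zetaWeight v * (1 - cos (t * tan v)) =
      t / (1 - exp (-t)) - t / 2 - 1 := by
  rw [← integral_csch_sq_mul_one_sub_cos ht, ← tan_image_Ioo,
    integral_image_eq_integral_abs_deriv_smul measurableSet_Ioo (f' := fun v ↦ 1 / cos v ^ 2)]
  · congr 1
    refine setIntegral_congr_fun measurableSet_Ioo fun v hv ↦ ?_
    simp only [smul_eq_mul]
    rw [abs_of_nonneg (by positivity), zetaWeight, realSec]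
    ring
  · intro v hv
    have hc : 0 < cos v := cos_pos_of_mem_Ioo ⟨by linarith [hv.1, pi_pos], hv.2⟩
    exact (Real.hasDerivAt_tan hc.ne').hasDerivWithinAt
  · exact Real.injOn_tan.mono (Ioo_subset_Ioo_left (by linarith [pi_pos]))

/-! ### Euler's integral with complex rate -/

theorem differentiableOn_integral_cpow_mul_exp_neg_mul {a : ℂ} (ha : 0 < a.re) :
    DifferentiableOn ℂ (fun r : ℂ ↦ ∫ t in Ioi (0 : ℝ), (t : ℂ) ^ (a - 1) * Complex.exp (-(r * t)))
      {r | 0 < r.re} := by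
  intro r₀ hr₀
  have hr₀ : 0 < r₀.re := hr₀
  have hint : ∀ s : ℝ, -1 < s →
      IntegrableOn (fun t : ℝ ↦ t ^ s * exp (-(r₀.re / 2) * t)) (Ioi 0) := fun s hs ↦ by
    simpa using integrableOn_rpow_mul_exp_neg_mul_rpow hs one_pos (half_pos hr₀)
  have hmeas : ∀ r : ℂ, Measurable fun t : ℝ ↦ (t : ℂ) ^ (a - 1) * Complex.exp (-(r * t)) :=
    fun r ↦ by fun_prop
  have hnorm : ∀ r : ℂ, r₀.re / 2 ≤ r.re → ∀ t ∈ Ioi (0 : ℝ),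
      ‖(t : ℂ) ^ (a - 1) * Complex.exp (-(r * t))‖ ≤
        t ^ (a.re - 1) * exp (-(r₀.re / 2) * t) := by
    intro r hr t ht
    have ht : 0 < t := ht
    rw [norm_mul, Complex.norm_cpow_eq_rpow_re_of_pos ht, Complex.norm_exp]
    simp only [Complex.sub_re, Complex.one_re, Complex.neg_re, Complex.re_mul_ofReal]
    gcongr
    nlinarith
  refine (hasDerivAt_integral_of_dominated_loc_of_deriv_le (s := Metric.ball r₀ (r₀.re / 2))
    (F' := fun r t ↦ (-t : ℂ) * ((t : ℂ) ^ (a - 1) * Complex.exp (-(r * t))))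
    (bound := fun t ↦ t ^ a.re * exp (-(r₀.re / 2) * t)) (Metric.ball_mem_nhds _ (half_pos hr₀))
    (.of_forall fun r ↦ (hmeas r).aestronglyMeasurable) ?_ ?_ ?_ (hint _ (by linarith))
    ?_).2.differentiableAt.differentiableWithinAt
  · refine (hint (a.re - 1) (by linarith)).mono' (hmeas _).aestronglyMeasurable ?_
    filter_upwards [ae_restrict_mem measurableSet_Ioi] with t ht
    exact hnorm r₀ (by linarith) t ht
  · have := hmeas r₀
    exact Measurable.aestronglyMeasurable (by fun_prop)
  · filter_upwards [ae_restrict_mem measurableSet_Ioi] with t ht r hr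
    have ht' : 0 < t := ht
    have h1 := Complex.abs_re_le_norm (r - r₀)
    rw [Metric.mem_ball, dist_eq_norm] at hr
    rw [Complex.sub_re] at h1
    have h2 := neg_abs_le (r.re - r₀.re)
    rw [norm_mul, norm_neg, Complex.norm_real, norm_of_nonneg ht'.le]
    calc _ ≤ t * (t ^ (a.re - 1) * exp (-(r₀.re / 2) * t)) := by
          gcongr; exact hnorm r (by linarith) t ht
      _ = _ := by rw [Real.rpow_sub_one ht'.ne']; field_simp
  · refine .of_forall fun t r _ ↦ ?_
    have := ((((hasDerivAt_id' r).mul_const (t : ℂ)).fun_neg).cexp).const_mul ((t : ℂ) ^ (a - 1))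
    exact this.congr_deriv (by ring)

/-- Both sides are holomorphic in `r` on the right half-plane and agree for positive real `r`, which
accumulate at `1`. -/
theorem integral_cpow_mul_exp_neg_mul_Ioi_of_re_pos {a r : ℂ} (ha : 0 < a.re) (hr : 0 < r.re) :
    ∫ t in Ioi (0 : ℝ), (t : ℂ) ^ (a - 1) * Complex.exp (-(r * t)) =
      (1 / r) ^ a * Complex.Gamma a := by
  have hopen : IsOpen {r : ℂ | 0 < r.re} := isOpen_lt continuous_const Complex.continuous_re
  have hR : DifferentiableOn ℂ (fun r : ℂ ↦ (1 / r) ^ a * Complex.Gamma a) {r | 0 < r.re} := by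
    intro r hr
    have hr : 0 < r.re := hr
    have h0 : r ≠ 0 := fun h ↦ by simp [h] at hr
    have hs : 1 / r ∈ Complex.slitPlane := by
      left
      rw [one_div, Complex.inv_re]
      exact div_pos hr (Complex.normSq_pos.2 h0)
    refine (DifferentiableAt.mul_const ?_ _).differentiableWithinAt
    exact ((differentiableAt_const 1).fun_div differentiableAt_id h0).cpow_const hs
  refine AnalyticOnNhd.eqOn_of_preconnected_of_frequently_eq (𝕜 := ℂ)
    ((differentiableOn_integral_cpow_mul_exp_neg_mul ha).analyticOnNhd hopen) (hR.analyticOnNhd hopen)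
    (convex_halfSpace_re_gt 0).isPreconnected (z₀ := (1 : ℝ)) (by simp) ?_ hr
  have hreal : ∃ᶠ x : ℝ in nhdsWithin 1 {1}ᶜ,
      ∫ t in Ioi (0 : ℝ), (t : ℂ) ^ (a - 1) * Complex.exp (-((x : ℂ) * t)) =
        (1 / (x : ℂ)) ^ a * Complex.Gamma a := by
    refine Filter.Eventually.frequently ?_
    filter_upwards [mem_nhdsWithin_of_mem_nhds (Ioi_mem_nhds (zero_lt_one' ℝ))] with x hx
    exact Complex.integral_cpow_mul_exp_neg_mul_Ioi ha hx
  refine Filter.Tendsto.frequently ?_ hreal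
  refine tendsto_nhdsWithin_iff.2
    ⟨(Complex.continuous_ofReal.tendsto 1).mono_left nhdsWithin_le_nhds, ?_⟩
  filter_upwards [self_mem_nhdsWithin] with x hx
  simpa using hx

theorem Gamma_mul_exp_log_cos_add {a : ℂ} (ha : 0 < a.re) {v : ℝ}
    (hv : v ∈ Ioo (-(π / 2)) (π / 2)) :
    Complex.Gamma a * Complex.exp (a * (log (cos v) + v * Complex.I)) =
      ∫ t in Ioi (0 : ℝ), Complex.exp (-t) * (t : ℂ) ^ (a - 1) *
        Complex.exp (t * tan v * Complex.I) := by
  have hc : 0 < cos v := cos_pos_of_mem_Ioo hv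
  have hc' : Complex.cos v ≠ 0 := by rw [← Complex.ofReal_cos]; exact_mod_cast hc.ne'
  have hr : 0 < (1 - tan v * Complex.I : ℂ).re := by simp
  have h0 : (1 - tan v * Complex.I : ℂ) ≠ 0 := fun h ↦ by rw [h] at hr; simp at hr
  have h := integral_cpow_mul_exp_neg_mul_Ioi_of_re_pos ha hr
  have he : 1 / (1 - tan v * Complex.I : ℂ) = Complex.exp (log (cos v) + v * Complex.I) := by
    rw [Complex.exp_add, ← Complex.ofReal_exp, exp_log hc, Complex.exp_mul_I, div_eq_iff h0,
      Complex.ofReal_tan, Complex.tan_eq_sin_div_cos, Complex.ofReal_cos]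
    field_simp
    linear_combination -(Complex.sin_sq_add_cos_sq v) + Complex.sin v ^ 2 * Complex.I_sq
  -- As `|v| < π / 2`, the principal logarithm returns the exponent itself.
  rw [he, Complex.cpow_def_of_ne_zero (Complex.exp_ne_zero _), Complex.log_exp (by
    simp; linarith [hv.1, pi_pos]) (by simp; linarith [hv.2, pi_pos]), mul_comm (_ + _) a,
    mul_comm (Complex.exp _)] at h
  rw [← h]
  refine setIntegral_congr_fun measurableSet_Ioi fun t _ ↦ ?_
  rw [mul_comm (Complex.exp _), mul_assoc, ← Complex.exp_add]
  congr 2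
  ring

theorem integrableOn_exp_neg_mul_cpow {a : ℂ} (ha : 0 < a.re) :
    IntegrableOn (fun t : ℝ ↦ Complex.exp (-t) * (t : ℂ) ^ (a - 1)) (Ioi 0) := by
  have := Complex.GammaIntegral_convergent ha
  simpa only [Complex.ofReal_exp, Complex.ofReal_neg] using this

theorem Gamma_mul_one_sub_exp_pair {a : ℂ} (ha : 0 < a.re) {v : ℝ} (hv : v ∈ Ioo 0 (π / 2)) :
    Complex.Gamma a * (1 - (Complex.exp (a * (log (cos v) + v * Complex.I)) +
        Complex.exp (a * (log (cos v) - v * Complex.I))) / 2) =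
      ∫ t in Ioi (0 : ℝ), Complex.exp (-t) * (t : ℂ) ^ (a - 1) * ((1 - cos (t * tan v) : ℝ) : ℂ) := by
  have h1 := Gamma_mul_exp_log_cos_add ha (v := v) ⟨by linarith [hv.1, pi_pos], hv.2⟩
  have h2 := Gamma_mul_exp_log_cos_add ha (v := -v) ⟨by linarith [hv.2], by linarith [hv.1, pi_pos]⟩
  rw [cos_neg, tan_neg, Complex.ofReal_neg, Complex.ofReal_neg, neg_mul, ← sub_eq_add_neg] at h2
  have hi := integrableOn_exp_neg_mul_cpow ha
  have hosc : ∀ c : ℝ, IntegrableOn (fun t : ℝ ↦ Complex.exp (-t) * (t : ℂ) ^ (a - 1) *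
      Complex.exp (t * c * Complex.I)) (Ioi 0) := fun c ↦ by
    refine Integrable.mul_bdd (c := 1) hi (by fun_prop) (.of_forall fun t ↦ ?_)
    rw [← Complex.ofReal_mul, Complex.norm_exp_ofReal_mul_I]
  have h3 := hosc (-tan v)
  rw [Complex.ofReal_neg] at h3
  have hG : Complex.Gamma a = ∫ t in Ioi (0 : ℝ), Complex.exp (-t) * (t : ℂ) ^ (a - 1) := by
    rw [Complex.Gamma_eq_integral ha, Complex.GammaIntegral]
    simp only [Complex.ofReal_exp, Complex.ofReal_neg]
  calc _ = Complex.Gamma a - (Complex.Gamma a * Complex.exp (a * (log (cos v) + v * Complex.I)) +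
        Complex.Gamma a * Complex.exp (a * (log (cos v) - v * Complex.I))) / 2 := by ring
    _ = _ := by
      rw [h1, h2]
      conv_lhs => rw [hG]
      rw [← integral_add (hosc _) h3, ← integral_div, ← integral_sub hi
        ((Integrable.fun_add (hosc _) h3).div_const 2)]
      refine setIntegral_congr_fun measurableSet_Ioi fun t _ ↦ ?_
      push_cast
      rw [Complex.cos, mul_neg]
      ring

/-! ### The formula for `Re k > 1` -/

theorem Gamma_mul_riemannZeta_eq_integral {s : ℂ} (hs : 1 < s.re) :
    Complex.Gamma s * riemannZeta s = ∫ t in Ioi (0 : ℝ),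
      (t : ℂ) ^ (s - 1) * ((exp (-t) / (1 - exp (-t)) : ℝ) : ℂ) := by
  have hnorm : ∀ n : ℕ, ((n + 1 : ℝ) ^ s.re) = ((n + 1 : ℕ) : ℝ) ^ s.re := by simp
  have h := hasSum_mellin (ι := ℕ) (a := fun _ ↦ 1) (p := fun n ↦ n + 1) (s := s)
    (F := fun t ↦ ((exp (-t) / (1 - exp (-t)) : ℝ) : ℂ)) (fun n ↦ Or.inr (by positivity))
    (by linarith) ?_ ?_
  · rw [zeta_eq_tsum_one_div_nat_add_one_cpow hs, ← tsum_mul_left]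
    have := h.tsum_eq
    simp only [mellin, smul_eq_mul] at this
    rw [← this]
    congr 1; ext n
    push_cast; ring
  · intro t ht
    have hlt : exp (-t) < 1 := by simpa using ht
    have hg := (hasSum_geometric_of_lt_one (exp_pos _).le hlt).mul_left (exp (-t))
    have hg' := Complex.hasSum_ofReal.2 hg
    rw [div_eq_mul_inv]
    convert hg' using 2 with n
    rw [one_mul, ← Real.exp_nat_mul, ← Real.exp_add]
    congr 2; ring
  · simp only [norm_one, hnorm]
    exact (summable_nat_add_iff 1).2 (Real.summable_one_div_nat_rpow.2 hs)

theorem zetaWeight_mul_one_sub_cos_le (t : ℝ) {v : ℝ} (hv : v ∈ Ioo 0 (π / 2)) :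
    zetaWeight v * (1 - cos (t * tan v)) ≤ 2 * exp 1 * t ^ 2 := by
  have h1 : 1 - cos (t * tan v) ≤ t ^ 2 * tan v ^ 2 := by
    have := one_sub_sq_div_two_le_cos (x := t * tan v)
    nlinarith [sq_nonneg (t * tan v)]
  have h2 := zetaWeight_mul_le 0 hv
  norm_num at h2
  calc _ ≤ zetaWeight v * (t ^ 2 * tan v ^ 2) := by gcongr; exact zetaWeight_nonneg v
    _ = (zetaWeight v * tan v ^ 2) * t ^ 2 := by ring
    _ ≤ _ := by gcongr

/-- Licenses Fubini. The `t²` bound uniform in `v` gives the dominating function `2e · exp (-t)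
t^(a+1)`, a Gamma integrand on a strip of finite width. -/
theorem integrable_zetaWeight_kernel {a : ℂ} (ha : 0 < a.re) :
    Integrable (Function.uncurry fun (v t : ℝ) ↦ (zetaWeight v : ℂ) *
      (Complex.exp (-t) * (t : ℂ) ^ (a - 1) * ((1 - cos (t * tan v) : ℝ) : ℂ)))
      ((volume.restrict (Ioo 0 (π / 2))).prod (volume.restrict (Ioi 0))) := by
  have htan : Measurable tan := by
    rw [show tan = fun x ↦ sin x / cos x from funext tan_eq_sin_div_cos]; fun_prop
  have hw := measurable_zetaWeight
  have ha2 : 0 < (a + 2).re := by simp; linarith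
  have hdom : Integrable (fun z : ℝ × ℝ ↦ ((2 * exp 1 : ℝ) : ℂ) *
      (Complex.exp (-z.2) * (z.2 : ℂ) ^ (a + 2 - 1)))
      ((volume.restrict (Ioo 0 (π / 2))).prod (volume.restrict (Ioi 0))) :=
    Integrable.mul_prod (f := fun _ ↦ ((2 * exp 1 : ℝ) : ℂ)) (integrable_const _)
      (integrableOn_exp_neg_mul_cpow ha2)
  refine hdom.mono ?_ ?_
  · apply Measurable.aestronglyMeasurable
    unfold Function.uncurry
    fun_prop
  · rw [Measure.prod_restrict]
    filter_upwards [ae_restrict_mem (measurableSet_Ioo.prod measurableSet_Ioi)] with ⟨v, t⟩ ⟨hv, ht⟩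
    have ht : 0 < t := ht
    have ht0 : (t : ℂ) ≠ 0 := by exact_mod_cast ht.ne'
    have hcos : 0 ≤ 1 - cos (t * tan v) := by linarith [cos_le_one (t * tan v)]
    have e : (t : ℂ) ^ (a + 2 - 1) = (t : ℂ) ^ (a - 1) * (t : ℂ) ^ 2 := by
      rw [← Complex.cpow_ofNat, ← Complex.cpow_add _ _ ht0]; congr 1; ring
    simp only [Function.uncurry, e, norm_mul, norm_pow, Complex.norm_real,
      norm_of_nonneg (zetaWeight_nonneg v), norm_of_nonneg hcos, norm_of_nonneg ht.le]
    rw [norm_of_nonneg zero_le_two, norm_of_nonneg (exp_pos 1).le]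
    have := mul_le_mul_of_nonneg_left (zetaWeight_mul_one_sub_cos_le t hv)
      (show 0 ≤ ‖Complex.exp (-t)‖ * ‖(t : ℂ) ^ (a - 1)‖ by positivity)
    linarith

theorem integral_zetaIntegrand_of_one_lt_re {k : ℂ} (hk : 1 < k.re) :
    Complex.Gamma (k - 1) * (π * ∫ v in Ioo 0 (π / 2), zetaIntegrand k v) =
      Complex.Gamma k * riemannZeta k - Complex.Gamma k / 2 - Complex.Gamma (k - 1) := by
  have ha : 0 < (k - 1).re := by simpa
  have hk0 : 0 < k.re := by linarith
  have hint := integrable_zetaWeight_kernel ha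
  have h1 : Complex.Gamma (k - 1) * (π * ∫ v in Ioo 0 (π / 2), zetaIntegrand k v) =
      π * ∫ v in Ioo 0 (π / 2), ∫ t in Ioi (0 : ℝ), (zetaWeight v : ℂ) *
      (Complex.exp (-t) * (t : ℂ) ^ (k - 1 - 1) * ((1 - cos (t * tan v) : ℝ) : ℂ)) := by
    rw [mul_left_comm, ← integral_const_mul]
    congr 1
    refine setIntegral_congr_fun measurableSet_Ioo fun v hv ↦ ?_
    rw [zetaIntegrand_eq k hv, integral_const_mul, ← Gamma_mul_one_sub_exp_pair ha hv]
    ring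
  have h2 : ∀ t ∈ Ioi (0 : ℝ), π * (∫ v in Ioo 0 (π / 2), (zetaWeight v : ℂ) *
      (Complex.exp (-t) * (t : ℂ) ^ (k - 1 - 1) * ((1 - cos (t * tan v) : ℝ) : ℂ))) =
      (t : ℂ) ^ (k - 1) * ((exp (-t) / (1 - exp (-t)) : ℝ) : ℂ) -
        Complex.exp (-t) * (t : ℂ) ^ (k - 1) / 2 - Complex.exp (-t) * (t : ℂ) ^ (k - 1 - 1) := by
    intro t ht
    have ht0 : (t : ℂ) ≠ 0 := by exact_mod_cast (ne_of_gt ht)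
    have hJ := congrArg ((↑) : ℝ → ℂ) (integral_zetaWeight_mul_one_sub_cos ht)
    rw [Complex.ofReal_mul, ← integral_complex_ofReal] at hJ
    have e : (t : ℂ) ^ (k - 1) = (t : ℂ) ^ (k - 1 - 1) * t := by
      have := Complex.cpow_add (k - 1 - 1) 1 ht0
      rwa [Complex.cpow_one, sub_add_cancel] at this
    calc _ = Complex.exp (-t) * (t : ℂ) ^ (k - 1 - 1) * (π * ∫ v in Ioo 0 (π / 2),
          ((zetaWeight v * (1 - cos (t * tan v)) : ℝ) : ℂ)) := by
          rw [← integral_const_mul, ← integral_const_mul, ← integral_const_mul]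
          congr 1; funext v; push_cast; ring
      _ = _ := by rw [hJ, e]; push_cast; ring
  have hi0 := integrableOn_exp_neg_mul_cpow ha
  have hi1 := (integrableOn_exp_neg_mul_cpow hk0).div_const 2
  have hJi := (hint.integral_prod_right).const_mul (π : ℂ)
  have hJi' := (integrable_congr ((ae_restrict_mem measurableSet_Ioi).mono h2)).1 hJi
  -- Fubini already makes the three-term combination integrable; adding back the two Gamma
  -- integrands isolates the zeta integrand.
  have hF : IntegrableOn (fun t : ℝ ↦ (t : ℂ) ^ (k - 1) *
      ((exp (-t) / (1 - exp (-t)) : ℝ) : ℂ)) (Ioi 0) := by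
    refine ((hJi'.add hi0).add hi1).congr (.of_forall fun t ↦ ?_)
    simp only [Pi.add_apply, sub_add_cancel]
  have hG : ∀ {a : ℂ}, 0 < a.re →
      Complex.Gamma a = ∫ t in Ioi (0 : ℝ), Complex.exp (-t) * (t : ℂ) ^ (a - 1) := fun ha ↦ by
    rw [Complex.Gamma_eq_integral ha, Complex.GammaIntegral]
    simp only [Complex.ofReal_exp, Complex.ofReal_neg]
  rw [h1, integral_integral_swap hint, ← integral_const_mul,
    setIntegral_congr_fun measurableSet_Ioi h2]
  refine (integral_sub (hF.sub hi1) hi0).trans ?_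
  rw [integral_sub' hF hi1, integral_div, ← hG ha, ← hG hk0, ← Gamma_mul_riemannZeta_eq_integral hk]

/-! ### Analytic continuation to all `k` -/

/-- `riemannZeta₁` is the entire function extending `(k - 1) ζ(k)`, so the pole at `1` does not
obstruct the identity theorem, applied near `2`. -/
theorem riemannZeta₁_eq_integral (k : ℂ) : riemannZeta₁ k =
    1 + (k - 1) / 2 + π * ∫ v in Ioo 0 (π / 2), zetaIntegrand k v := by
  have hd := differentiable_integral_zetaIntegrand
  have hR : Differentiable ℂ fun k : ℂ ↦ 1 + (k - 1) / 2 +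
    π * ∫ v in Ioo 0 (π / 2), zetaIntegrand k v := by fun_prop
  refine congrFun (AnalyticOnNhd.eq_of_eventuallyEq (z₀ := (2 : ℂ))
    (Complex.analyticOnNhd_univ_iff_differentiable.2 differentiable_riemannZeta₁)
    (Complex.analyticOnNhd_univ_iff_differentiable.2 hR) ?_) k
  filter_upwards [(isOpen_lt continuous_const Complex.continuous_re).mem_nhds
    (show (1 : ℝ) < (2 : ℂ).re by norm_num)] with s hs
  have hs : 1 < s.re := hs
  have hs1 : s - 1 ≠ 0 := fun h ↦ by
    rw [sub_eq_zero.1 h] at hs; simp at hs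
  have hΓ : Complex.Gamma (s - 1) ≠ 0 := Complex.Gamma_ne_zero_of_re_pos (by simpa)
  have h := integral_zetaIntegrand_of_one_lt_re hs
  have hrec : Complex.Gamma s = (s - 1) * Complex.Gamma (s - 1) := by
    simpa using Complex.Gamma_add_one (s - 1) hs1
  rw [riemannZeta_eq_inv_sub_mul (sub_ne_zero.1 hs1), hrec] at h
  apply mul_left_cancel₀ hΓ
  field_simp at h ⊢
  linear_combination -h

theorem mainTheorem4 (k : ℂ) (hk : k ≠ 1) :
    IntervalIntegrable (zetaIntegrand k) MeasureTheory.volume 0 (Real.pi / 2) ∧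
    riemannZeta k = 1 / (k - 1) + 1 / 2 +
      (Real.pi : ℂ) / (k - 1) * ∫ v in (0 : ℝ)..(Real.pi / 2), zetaIntegrand k v := by
  have hpi : 0 ≤ Real.pi / 2 := by positivity
  refine ⟨(intervalIntegrable_iff_integrableOn_Ioo_of_le hpi).2 (integrableOn_zetaIntegrand k), ?_⟩
  have hk1 : k - 1 ≠ 0 := sub_ne_zero.2 hk
  rw [intervalIntegral.integral_of_le hpi, integral_Ioc_eq_integral_Ioo,
    riemannZeta_eq_inv_sub_mul hk, riemannZeta₁_eq_integral]
  field_simp
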